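/- Let $\Bbbk$ be an algebraically closed field of characteristic $0$, let $1\le k\le n$, and let permutations act on $\Omega=\{1,\dots,n\}$ from the right, $x\mapsto x^g$, so that products in $S_n$ are read from left to right. Put $\Gamma=\{1,\dots,n-k\}$ and $\Delta=\{n-k+1,\dots,n\}$. Let $F=S_{n-k}\le S_n$ be the subgroup of all permutations that fix every point of $\Delta$, and let $G\le S_n$ be sharply $k$-transitive: for any two $k$-tuples of distinct points of $\Omega$ exactly one element of $G$ maps the first to the second. Let $S_n=F\cdot G$ be the exact factorization (every element of $S_n$ is $fg$ for unique $f\in F$, $g\in G$). For $g\in G$, $f\in F$ define $g\triangleright f\in F$ and $g\triangleleft f\in G$ by $gf=(g\triangleright f)(g\triangleleft f)$; then $\triangleleft$ is a right action of $F$ on the set $G$. Let $\mathcal O_x$ and $F_x$ be the $F$-orbit and the stabilizer of $x\in G$ for this action. Let $H=\Bbbk^G\#\Bbbk F$ be the bismash product Hopf algebra: it has basis $p_x\#a$ ($x\in G$, $a\in F$), product $(p_x\#a)(p_y\#b)=\delta_{x\triangleleft a,\,y}\;p_x\#ab$, coproduct $\Delta(p_x\#a)=\sum_{y\in G}p_{xy^{-1}}\#(y\triangleright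 a)\otimes p_y\#a$, counit $\varepsilon(p_x\#a)=\delta_{x,1}$ and antipode $S(p_x\#a)=p_{(x\triangleleft a)^{-1}}\#(x\triangleright a)^{-1}$. The Frobenius–Schur indicator of an $H$-module with character $\chi$ is $\chi\big(\sum\Lambda_1\Lambda_2\big)$, where $\Lambda=\frac1{|F|}\sum_{a\in F}p_1\#a$ is the integral of $H$ with $\varepsilon(\Lambda)=1$. For $x\in G$ and an $F_x$-module $V$, the induced module $\widehat V=\Bbbk F\otimes_{\Bbbk F_x}V$ is an $H$-module by $(p_y\#a)(b\otimes v)=\delta_{y\triangleleft(ab),\,x}\;ab\otimes v$. The orbit $\mathcal O_x$ is a *null indicator orbit* if $\widehat V$ has indicator $0$ for every irreducible $F_x$-module $V$. For $g\in G$ and $1\le i\le k$ let $\alpha_i(g)=(n-k+i)^g$ and $I(g)=\{i:\alpha_i(g)\in\Gamma\}$. For $I\subseteq\{1,\dots,k\}$ and a tuple $D=(D_j)_{j\notin I}$ of distinct elements of $\Delta$, the *member* $\mathcal M_{I,D}$ is the set of all $g\in G$ with $I(g)=I$ and $\alpha_j(g)=D_j$ for all $j\notin I$; the *$m$-family* is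 the set of all members $\mathcal M_{I,D}$ with $|I|=m$. **Theorem.** Let $0\le m\le k$ and $m\le n-k$ (the second condition holds for every $m\le k$ if $k\le n/2$). Then every member in the $m$-family is an $F$-orbit of $G$, and the number of members in the $m$-family that are not null indicator orbits is $$\binom{k}{m}\cdot i_{k-m},$$ where $i_j$ is the number of $\sigma\in S_j$ with $\sigma^2=1$ (so the identity is counted, and $i_0=1$). -/

import Mathlib

open scoped TensorProduct

universe u

/-- A matched pair of groups: a left action `x ▷ a = lact x a` of `G` on the set `F` and a right
action `x ◁ a = ract x a` of `F` on the set `G`, with the two compatibility conditions. -/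
structure MatchedPair (F G : Type*) [Group F] [Group G] where
  lact : G → F → F
  ract : G → F → G
  one_lact : ∀ a, lact 1 a = a
  mul_lact : ∀ x y a, lact (x * y) a = lact x (lact y a)
  ract_one : ∀ x, ract x 1 = x
  ract_mul : ∀ x a b, ract x (a * b) = ract (ract x a) b
  lact_mul : ∀ x a b, lact x (a * b) = lact x a * lact (ract x a) b
  mul_ract : ∀ x y a, ract (x * y) a = ract x (lact y a) * ract y a

namespace MatchedPair

variable {F G : Type*} [Group F] [Group G] (M : MatchedPair F G)

theorem lact_one (x : G) : M.lact x 1 = 1 := by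
  have h := M.lact_mul x 1 1
  rw [mul_one, M.ract_one] at h
  exact (mul_eq_left.mp h.symm)

theorem one_ract (a : F) : M.ract 1 a = 1 := by
  have h := M.mul_ract 1 1 a
  rw [mul_one, M.one_lact] at h
  exact (mul_eq_left.mp h.symm)

theorem ract_mul_inv (x y : G) (a : F) :
    M.ract (x * y⁻¹) (M.lact y a) = M.ract x a * (M.ract y a)⁻¹ := by
  rw [eq_mul_inv_iff_mul_eq, ← M.mul_ract, inv_mul_cancel_right]

theorem lact_mul_inv (x y : G) (a : F) : M.lact (x * y⁻¹) (M.lact y a) = M.lact x a := by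
  rw [← M.mul_lact, inv_mul_cancel_right]

/-- The orbit `𝒪_x` of `x ∈ G` under the action `◁` of `F`. -/
def orbit (x : G) : Set G := Set.range fun a : F => M.ract x a

/-- The stabilizer `F_x` of `x ∈ G` in `F` under the action `◁`. -/
def stab (x : G) : Subgroup F where
  carrier := {a | M.ract x a = x}
  one_mem' := M.ract_one x
  mul_mem' {a b} ha hb := by
    simp only [Set.mem_ofPred_eq] at *
    rw [M.ract_mul, ha, hb]
  inv_mem' {a} ha := by
    simp only [Set.mem_ofPred_eq] at *
    calc M.ract x a⁻¹ = M.ract (M.ract x a) a⁻¹ := by rw [ha]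
      _ = x := by rw [← M.ract_mul, mul_inv_cancel, M.ract_one]

end MatchedPair

section ExactFactorization

variable {L : Type*} [Group L] {F G : Subgroup L}

/-- The matched pair of an exact factorization `L = F G` (every element of `L` is `f * g` for a
unique `f ∈ F` and a unique `g ∈ G`): for `g ∈ G` and `f ∈ F`, the elements `g ▷ f ∈ F` and
`g ◁ f ∈ G` are those with `g * f = (g ▷ f) * (g ◁ f)`. -/
noncomputable def exactMatchedPair (h : Subgroup.IsComplement' F G) : MatchedPair F G :=
  have uniq : ∀ (f f' : F) (g g' : G), (f : L) * g = f' * g' → f = f' ∧ g = g' := by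
    intro f f' g g' e
    have := h.1 (a₁ := (f, g)) (a₂ := (f', g')) e
    exact ⟨congrArg Prod.fst this, congrArg Prod.snd this⟩
  have spec : ∀ (g : G) (f : F), ((h.equiv ((g : L) * f)).1 : L) * (h.equiv ((g : L) * f)).2
      = (g : L) * f := fun g f => h.equiv_fst_mul_equiv_snd _
  { lact := fun g f => (h.equiv ((g : L) * f)).1
    ract := fun g f => (h.equiv ((g : L) * f)).2
    one_lact := fun a => (uniq _ a _ 1 (by rw [spec]; simp)).1
    ract_one := fun x => (uniq _ 1 _ x (by rw [spec]; simp)).2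
    mul_lact := fun x y a => (uniq _ ((h.equiv ((x : L) * ((h.equiv ((y : L) * a)).1 : F))).1) _
      ((h.equiv ((x : L) * ((h.equiv ((y : L) * a)).1 : F))).2 * (h.equiv ((y : L) * a)).2) (by
        rw [spec, Subgroup.coe_mul, Subgroup.coe_mul, ← mul_assoc, spec, mul_assoc, mul_assoc,
          spec])).1
    mul_ract := fun x y a => (uniq _ ((h.equiv ((x : L) * ((h.equiv ((y : L) * a)).1 : F))).1) _
      ((h.equiv ((x : L) * ((h.equiv ((y : L) * a)).1 : F))).2 * (h.equiv ((y : L) * a)).2) (by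
        rw [spec, Subgroup.coe_mul, Subgroup.coe_mul, ← mul_assoc, spec, mul_assoc, mul_assoc,
          spec])).2
    lact_mul := fun x a b => (uniq _
      ((h.equiv ((x : L) * a)).1 * (h.equiv (((h.equiv ((x : L) * a)).2 : G) * (b : L))).1) _
      (h.equiv (((h.equiv ((x : L) * a)).2 : G) * (b : L))).2 (by
        rw [spec, Subgroup.coe_mul, Subgroup.coe_mul, mul_assoc, spec, ← mul_assoc, ← mul_assoc,
          spec])).1
    ract_mul := fun x a b => (uniq _
      ((h.equiv ((x : L) * a)).1 * (h.equiv (((h.equiv ((x : L) * a)).2 : G) * (b : L))).1) _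
      (h.equiv (((h.equiv ((x : L) * a)).2 : G) * (b : L))).2 (by
        rw [spec, Subgroup.coe_mul, Subgroup.coe_mul, mul_assoc, spec, ← mul_assoc, ← mul_assoc,
          spec])).2 }

theorem exactMatchedPair_spec (h : Subgroup.IsComplement' F G) (g : G) (f : F) :
    (g : L) * f = ((exactMatchedPair h).lact g f : L) * ((exactMatchedPair h).ract g f : L) :=
  (h.equiv_fst_mul_equiv_snd _).symm

end ExactFactorization

/-- The underlying space of the bismash product `𝕜^G # 𝕜F`: the vector space over `𝕜` with basis
`p_x # a`, `x ∈ G`, `a ∈ F`. -/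
def Bismash (𝕜 : Type*) [Field 𝕜] {F G : Type*} [Group F] [Group G] (_M : MatchedPair F G) :=
  (G × F) →₀ 𝕜

namespace Bismash

open scoped Classical

noncomputable section

variable {𝕜 : Type*} [Field 𝕜] {F G : Type*} [Group F] [Group G] {M : MatchedPair F G}

instance : AddCommGroup (Bismash 𝕜 M) := inferInstanceAs (AddCommGroup ((G × F) →₀ 𝕜))
instance : Module 𝕜 (Bismash 𝕜 M) := inferInstanceAs (Module 𝕜 ((G × F) →₀ 𝕜))

/-- The basis element `p_x # a`. -/
def p (𝕜 : Type*) [Field 𝕜] {F G : Type*} [Group F] [Group G] (M : MatchedPair F G)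
    (x : G) (a : F) : Bismash 𝕜 M := Finsupp.single (x, a) (1 : 𝕜)

/-- The linear map on `𝕜^G # 𝕜F` with prescribed values on the basis `p_x # a`. -/
def lin {W : Type*} [AddCommGroup W] [Module 𝕜 W] (f : G → F → W) : Bismash 𝕜 M →ₗ[𝕜] W :=
  Finsupp.linearCombination 𝕜 fun xa : G × F => f xa.1 xa.2

@[simp] theorem lin_p {W : Type*} [AddCommGroup W] [Module 𝕜 W] (f : G → F → W) (x : G) (a : F) :
    lin f (p 𝕜 M x a) = f x a :=
  (Finsupp.linearCombination_single 𝕜 (1 : 𝕜) (x, a)).trans (one_smul _ _)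

theorem hom_ext {W : Type*} [AddCommGroup W] [Module 𝕜 W] {f g : Bismash 𝕜 M →ₗ[𝕜] W}
    (h : ∀ x a, f (p 𝕜 M x a) = g (p 𝕜 M x a)) : f = g :=
  Finsupp.lhom_ext' fun xa => LinearMap.ext_ring (h xa.1 xa.2)

@[elab_as_elim]
theorem induct {P : Bismash 𝕜 M → Prop} (u : Bismash 𝕜 M) (hp : ∀ x a, P (p 𝕜 M x a))
    (hadd : ∀ u v, P u → P v → P (u + v)) (hsmul : ∀ (c : 𝕜) u, P u → P (c • u)) : P u := by
  refine Finsupp.induction_linear (motive := P) u ?_ hadd ?_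
  · exact (zero_smul 𝕜 (p 𝕜 M 1 1)) ▸ hsmul 0 _ (hp 1 1)
  · intro xa c
    have e : c • p 𝕜 M xa.1 xa.2 = (Finsupp.single xa c : (G × F) →₀ 𝕜) :=
      (Finsupp.smul_single c xa (1 : 𝕜)).trans (by rw [smul_eq_mul, mul_one])
    exact e ▸ hsmul c _ (hp xa.1 xa.2)

/-- Multiplication: `(p_x # a)(p_y # b) = p_x (a ⇀ p_y) # ab` with `a ⇀ p_y = p_{y ◁ a⁻¹}`, that
is, `p_x # ab` if `x = y ◁ a⁻¹` and `0` otherwise. -/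
def mulHom : Bismash 𝕜 M →ₗ[𝕜] Bismash 𝕜 M →ₗ[𝕜] Bismash 𝕜 M :=
  lin fun x a => lin fun y b => if x = M.ract y a⁻¹ then p 𝕜 M x (a * b) else 0

instance : Mul (Bismash 𝕜 M) := ⟨fun u v => mulHom u v⟩

theorem mul_def (u v : Bismash 𝕜 M) : u * v = mulHom u v := rfl

theorem eq_ract_inv_iff (x y : G) (a : F) : x = M.ract y a⁻¹ ↔ M.ract x a = y := by
  constructor
  · rintro rfl
    rw [← M.ract_mul, inv_mul_cancel, M.ract_one]
  · rintro rfl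
    rw [← M.ract_mul, mul_inv_cancel, M.ract_one]

theorem p_mul_p (x y : G) (a b : F) :
    p 𝕜 M x a * p 𝕜 M y b = if M.ract x a = y then p 𝕜 M x (a * b) else 0 := by
  simp only [mul_def, mulHom, lin_p, eq_ract_inv_iff]

/-- The identity `1 # 1 = ∑_x p_x # 1`. -/
instance [Fintype G] : One (Bismash 𝕜 M) := ⟨∑ x : G, p 𝕜 M x 1⟩

theorem one_def [Fintype G] : (1 : Bismash 𝕜 M) = ∑ x : G, p 𝕜 M x 1 := rfl

theorem mul_assoc' (u v w : Bismash 𝕜 M) : u * v * w = u * (v * w) := by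
  induction u using induct with
  | hadd u u' hu hu' => simp only [mul_def, map_add, LinearMap.add_apply] at *; rw [hu, hu']
  | hsmul c u hu => simp only [mul_def, map_smul, LinearMap.smul_apply] at *; rw [hu]
  | hp x a =>
  induction v using induct with
  | hadd u u' hu hu' => simp only [mul_def, map_add, LinearMap.add_apply] at *; rw [hu, hu']
  | hsmul c u hu => simp only [mul_def, map_smul, LinearMap.smul_apply] at *; rw [hu]
  | hp y b =>
  induction w using induct with
  | hadd u u' hu hu' => simp only [mul_def, map_add] at *; rw [hu, hu']
  | hsmul c u hu => simp only [mul_def, map_smul] at *; rw [hu]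
  | hp z c =>
  rw [p_mul_p, p_mul_p]
  by_cases h1 : M.ract x a = y
  · subst h1
    rw [if_pos rfl, p_mul_p, M.ract_mul]
    split_ifs with h2
    · rw [p_mul_p, if_pos rfl, mul_assoc]
    · simp [mul_def]
  · rw [if_neg h1]
    split_ifs with h2
    · rw [p_mul_p, if_neg h1]; simp [mul_def]
    · simp [mul_def]

variable [Fintype G]

theorem one_mul' (u : Bismash 𝕜 M) : 1 * u = u := by
  induction u using induct with
  | hadd u u' hu hu' => simp only [mul_def, map_add] at *; rw [hu, hu']
  | hsmul c u hu => simp only [mul_def, map_smul] at *; rw [hu]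
  | hp x a =>
    have : ∀ y, mulHom (p 𝕜 M y 1) (p 𝕜 M x a) = if y = x then p 𝕜 M x a else 0 := by
      intro y
      rw [← mul_def, p_mul_p, M.ract_one, one_mul]
      split_ifs with h
      · rw [h]
      · rfl
    simp only [mul_def, one_def, map_sum, LinearMap.sum_apply, this]
    simp

theorem mul_one' (u : Bismash 𝕜 M) : u * 1 = u := by
  induction u using induct with
  | hadd u u' hu hu' => simp only [mul_def, map_add, LinearMap.add_apply] at *; rw [hu, hu']
  | hsmul c u hu => simp only [mul_def, map_smul, LinearMap.smul_apply] at *; rw [hu]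
  | hp x a =>
    simp only [mul_def, one_def, map_sum]
    simp only [← mul_def, p_mul_p, mul_one]
    simp

instance : Ring (Bismash 𝕜 M) :=
  { (inferInstance : AddCommGroup (Bismash 𝕜 M)) with
    mul := (· * ·)
    one := 1
    left_distrib := fun u v w => by simp only [mul_def, map_add]
    right_distrib := fun u v w => by simp only [mul_def, map_add, LinearMap.add_apply]
    zero_mul := fun u => by simp only [mul_def, map_zero, LinearMap.zero_apply]
    mul_zero := fun u => by simp only [mul_def, map_zero]
    mul_assoc := mul_assoc'
    one_mul := one_mul'
    mul_one := mul_one' }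

instance : Algebra 𝕜 (Bismash 𝕜 M) :=
  Algebra.ofModule
    (fun c u v => by
      change mulHom (c • u) v = c • mulHom u v
      rw [map_smul, LinearMap.smul_apply])
    (fun c u v => by
      change mulHom u (c • v) = c • mulHom u v
      rw [map_smul])

/-- Comultiplication: `Δ(p_x # a) = ∑_y p_{x y⁻¹} # (y ▷ a) ⊗ p_y # a`. -/
def comulHom : Bismash 𝕜 M →ₗ[𝕜] Bismash 𝕜 M ⊗[𝕜] Bismash 𝕜 M :=
  lin fun x a => ∑ y : G, p 𝕜 M (x * y⁻¹) (M.lact y a) ⊗ₜ[𝕜] p 𝕜 M y a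

/-- Counit: `ε(p_x # a) = δ_{x,1}`. -/
def counitHom : Bismash 𝕜 M →ₗ[𝕜] 𝕜 := lin fun x _ => if x = 1 then 1 else 0

/-- Antipode: `S(p_x # a) = p_{(x ◁ a)⁻¹} # (x ▷ a)⁻¹`. -/
def antipodeHom : Bismash 𝕜 M →ₗ[𝕜] Bismash 𝕜 M :=
  lin fun x a => p 𝕜 M (M.ract x a)⁻¹ (M.lact x a)⁻¹

instance : Coalgebra 𝕜 (Bismash 𝕜 M) where
  comul := comulHom
  counit := counitHom
  coassoc := by
    refine hom_ext fun x a => ?_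
    simp only [LinearMap.comp_apply, LinearEquiv.coe_coe, comulHom, lin_p, map_sum,
      LinearMap.rTensor_tmul, LinearMap.lTensor_tmul, TensorProduct.sum_tmul,
      TensorProduct.tmul_sum, TensorProduct.assoc_tmul]
    conv_rhs => rw [Finset.sum_comm]
    refine Finset.sum_congr rfl fun y _ => ?_
    refine Fintype.sum_equiv (Equiv.mulRight y) _ _ fun w => ?_
    rw [Equiv.coe_mulRight, mul_inv_cancel_right, mul_inv_rev, M.mul_lact, mul_assoc]
  rTensor_counit_comp_comul := by
    refine hom_ext fun x a => ?_
    simp only [LinearMap.comp_apply, comulHom, lin_p, map_sum, LinearMap.rTensor_tmul, counitHom,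
      TensorProduct.mk_apply]
    rw [Finset.sum_eq_single x]
    · rw [mul_inv_cancel, if_pos rfl]
    · intro y _ hy
      rw [if_neg (fun h => hy (mul_inv_eq_one.mp h).symm), TensorProduct.zero_tmul]
    · simp
  lTensor_counit_comp_comul := by
    refine hom_ext fun x a => ?_
    simp only [LinearMap.comp_apply, comulHom, lin_p, map_sum, LinearMap.lTensor_tmul, counitHom,
      LinearMap.flip_apply, TensorProduct.mk_apply]
    rw [Finset.sum_eq_single 1]
    · rw [if_pos rfl, inv_one, mul_one, M.one_lact]
    · intro y _ hy
      rw [if_neg hy, TensorProduct.tmul_zero]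
    · simp

theorem comul_p (x : G) (a : F) : Coalgebra.comul (R := 𝕜) (p 𝕜 M x a)
    = ∑ y : G, p 𝕜 M (x * y⁻¹) (M.lact y a) ⊗ₜ[𝕜] p 𝕜 M y a := lin_p _ _ _

theorem counit_p (x : G) (a : F) : Coalgebra.counit (R := 𝕜) (p 𝕜 M x a)
    = if x = 1 then 1 else 0 := lin_p _ _ _

theorem counit_mul' (u v : Bismash 𝕜 M) : Coalgebra.counit (R := 𝕜) (u * v)
    = Coalgebra.counit (R := 𝕜) u * Coalgebra.counit (R := 𝕜) v := by
  induction u using induct with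
  | hadd u u' hu hu' => simp only [add_mul, map_add]; rw [hu, hu']
  | hsmul c u hu => simp only [smul_mul_assoc, map_smul]; rw [hu]
  | hp x a =>
  induction v using induct with
  | hadd u u' hu hu' => simp only [mul_add, map_add]; rw [hu, hu']
  | hsmul c u hu => simp only [mul_smul_comm, map_smul]; rw [hu]
  | hp y b =>
  rw [p_mul_p, counit_p, counit_p]
  by_cases hx : x = 1
  · subst hx
    rw [M.one_ract, if_pos rfl, one_mul]
    by_cases hy : y = 1
    · rw [if_pos hy, if_pos hy.symm, counit_p, if_pos rfl]
    · rw [if_neg hy, if_neg (Ne.symm hy), map_zero]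
  · rw [if_neg hx, zero_mul]
    split_ifs
    · rw [counit_p, if_neg hx]
    · rw [map_zero]

theorem comul_mul' (u v : Bismash 𝕜 M) : Coalgebra.comul (R := 𝕜) (u * v)
    = Coalgebra.comul (R := 𝕜) u * Coalgebra.comul (R := 𝕜) v := by
  induction u using induct with
  | hadd u u' hu hu' => simp only [add_mul, map_add]; rw [hu, hu']
  | hsmul c u hu => simp only [smul_mul_assoc, map_smul]; rw [hu]
  | hp x a =>
  induction v using induct with
  | hadd u u' hu hu' => simp only [mul_add, map_add]; rw [hu, hu']
  | hsmul c u hu => simp only [mul_smul_comm, map_smul]; rw [hu]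
  | hp z b =>
  have key : ∀ y w : G,
      (p 𝕜 M (x * y⁻¹) (M.lact y a) ⊗ₜ[𝕜] p 𝕜 M y a) *
        (p 𝕜 M (z * w⁻¹) (M.lact w b) ⊗ₜ[𝕜] p 𝕜 M w b)
      = if M.ract y a = w then (if M.ract x a = z then
          p 𝕜 M (x * y⁻¹) (M.lact y (a * b)) ⊗ₜ[𝕜] p 𝕜 M y (a * b) else 0) else 0 := by
    intro y w
    rw [Algebra.TensorProduct.tmul_mul_tmul, p_mul_p, p_mul_p]
    by_cases hw : M.ract y a = w
    · subst hw
      rw [if_pos rfl, if_pos rfl, M.ract_mul_inv, M.lact_mul]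
      simp only [mul_left_inj]
      split_ifs
      · rfl
      · rw [TensorProduct.zero_tmul]
    · rw [if_neg hw, if_neg hw, TensorProduct.tmul_zero]
  rw [comul_p, comul_p, Finset.sum_mul_sum]
  simp only [key, Finset.sum_ite_eq, Finset.mem_univ, if_true]
  rw [p_mul_p]
  split_ifs
  · rw [comul_p]
  · simp

/-- The bialgebra structure of `𝕜^G # 𝕜F`. -/
instance : Bialgebra 𝕜 (Bismash 𝕜 M) :=
  Bialgebra.mk' 𝕜 (Bismash 𝕜 M)
    (by
      rw [one_def, map_sum]
      change ∑ x : G, Coalgebra.counit (R := 𝕜) (p 𝕜 M x 1) = 1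
      simp [counit_p])
    (fun {u v} => counit_mul' u v)
    (by
      rw [one_def, map_sum]
      change ∑ x : G, Coalgebra.comul (R := 𝕜) (p 𝕜 M x 1) = 1
      simp only [comul_p, M.lact_one]
      rw [Algebra.TensorProduct.one_def, one_def, TensorProduct.sum_tmul]
      simp only [TensorProduct.tmul_sum]
      rw [Finset.sum_comm]
      conv_rhs => rw [Finset.sum_comm]
      refine Finset.sum_congr rfl fun y _ => ?_
      exact Fintype.sum_equiv (Equiv.mulRight y⁻¹) _ _ fun x => rfl)
    (fun {u v} => comul_mul' u v)

/-- The Hopf algebra structure of `𝕜^G # 𝕜F`. -/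
instance : HopfAlgebra 𝕜 (Bismash 𝕜 M) where
  antipode := antipodeHom
  mul_antipode_rTensor_comul := by
    refine hom_ext fun x a => ?_
    simp only [LinearMap.comp_apply, comul_p, counit_p, map_sum, LinearMap.rTensor_tmul,
      antipodeHom, lin_p, LinearMap.mul'_apply, Algebra.linearMap_apply, p_mul_p,
      M.lact_mul_inv, M.ract_mul_inv]
    have e : ∀ y : G, M.ract (M.ract x a * (M.ract y a)⁻¹)⁻¹ (M.lact x a)⁻¹ = y * x⁻¹ := by
      intro y
      rw [mul_inv_rev, inv_inv, ← M.ract_mul_inv, ← M.ract_mul, mul_inv_cancel, M.ract_one]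
    simp only [e, mul_eq_left, inv_eq_one]
    by_cases hx : x = 1
    · subst hx
      simp only [if_true, M.one_ract, M.one_lact, one_mul, inv_inv, inv_mul_cancel, map_one]
      refine (Fintype.sum_equiv (⟨fun y => M.ract y a, fun y => M.ract y a⁻¹, fun y => ?_,
        fun y => ?_⟩ : G ≃ G) _ (fun y => p 𝕜 M y 1) fun y => rfl)
      · change M.ract (M.ract y a) a⁻¹ = y
        rw [← M.ract_mul, mul_inv_cancel, M.ract_one]
      · change M.ract (M.ract y a⁻¹) a = y
        rw [← M.ract_mul, inv_mul_cancel, M.ract_one]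
    · simp [hx]
  mul_antipode_lTensor_comul := by
    refine hom_ext fun x a => ?_
    simp only [LinearMap.comp_apply, comul_p, counit_p, map_sum, LinearMap.lTensor_tmul,
      antipodeHom, lin_p, LinearMap.mul'_apply, Algebra.linearMap_apply, p_mul_p,
      M.ract_mul_inv, mul_eq_right, mul_inv_cancel]
    by_cases hx : x = 1
    · subst hx
      simp only [if_true, M.one_ract, one_mul, map_one]
      exact Fintype.sum_equiv (Equiv.inv G) _ (fun y => p 𝕜 M y 1) fun y => rfl
    · have : M.ract x a ≠ 1 := fun h => hx (by
        rw [← M.ract_one x, ← mul_inv_cancel a, M.ract_mul, h, M.one_ract])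
      simp [hx, this]

end

end Bismash

noncomputable section Indicators

/-- `Λ` is an integral of the Hopf algebra `H` with `ε(Λ) = 1`. -/
def IsNormalizedIntegral (𝕜 : Type*) {H : Type*} [Field 𝕜] [Ring H] [HopfAlgebra 𝕜 H] (Λ : H) :
    Prop :=
  (∀ h : H, h * Λ = Coalgebra.counit (R := 𝕜) h • Λ) ∧
  (∀ h : H, Λ * h = Coalgebra.counit (R := 𝕜) h • Λ) ∧ Coalgebra.counit (R := 𝕜) Λ = 1

theorem IsNormalizedIntegral.unique {𝕜 H : Type*} [Field 𝕜] [Ring H] [HopfAlgebra 𝕜 H] {Λ Λ' : H}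
    (h : IsNormalizedIntegral 𝕜 Λ) (h' : IsNormalizedIntegral 𝕜 Λ') : Λ = Λ' := by
  have h1 := h.1 Λ'
  have h2 := h'.2.1 Λ
  rw [h'.2.2, one_smul] at h1
  rw [h.2.2, one_smul] at h2
  rw [← h1, h2]

/-- The Frobenius-Schur indicator `ν₂(χ) = χ(Λ^{[2]})`, where `χ` is the character of the
`H`-module `W`, `Λ` is the normalized integral and `Λ^{[2]} = m(Δ(Λ)) = ∑ Λ₁ Λ₂`. -/
def schurIndicator {𝕜 H W : Type*} [Field 𝕜] [Ring H] [HopfAlgebra 𝕜 H] [AddCommGroup W]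
    [Module 𝕜 W] (Λ : H) (ρ : H →ₐ[𝕜] Module.End 𝕜 W) : 𝕜 :=
  LinearMap.trace 𝕜 W (ρ (LinearMap.mul' 𝕜 H (Coalgebra.comul (R := 𝕜) Λ)))

namespace Bismash

open scoped Classical

variable (𝕜 : Type*) [Field 𝕜] {F G : Type*} [Group F] [Group G] (M : MatchedPair F G)

/-- The element `(1 / |F|) ∑_{a ∈ F} p_1 # a`. -/
def integral [Fintype F] : Bismash 𝕜 M := (Fintype.card F : 𝕜)⁻¹ • ∑ a : F, p 𝕜 M 1 a

theorem isNormalizedIntegral_integral [CharZero 𝕜] [Fintype F] [Fintype G] :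
    IsNormalizedIntegral 𝕜 (integral 𝕜 M) := by
  refine ⟨fun h => ?_, fun h => ?_, ?_⟩
  · induction h using induct with
    | hadd u v hu hv => rw [add_mul, hu, hv, map_add, add_smul]
    | hsmul c u hu => rw [smul_mul_assoc, hu, map_smul, smul_assoc]
    | hp x b =>
      rw [integral, mul_smul_comm, Finset.mul_sum, counit_p]
      simp only [p_mul_p]
      by_cases hx : x = 1
      · subst hx
        simp only [M.one_ract, if_true, one_smul]
        congr 1
        exact Fintype.sum_equiv (Equiv.mulLeft b) _ _ fun a => rfl
      · have : M.ract x b ≠ 1 := fun h => hx (by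
          rw [← M.ract_one x, ← mul_inv_cancel b, M.ract_mul, h, M.one_ract])
        simp [hx, this]
  · induction h using induct with
    | hadd u v hu hv => rw [mul_add, hu, hv, map_add, add_smul]
    | hsmul c u hu => rw [mul_smul_comm, hu, map_smul, smul_assoc]
    | hp x b =>
      rw [integral, smul_mul_assoc, Finset.sum_mul, counit_p]
      simp only [p_mul_p, M.one_ract]
      by_cases hx : x = 1
      · subst hx
        simp only [if_true, one_smul]
        congr 1
        exact Fintype.sum_equiv (Equiv.mulRight b) _ _ fun a => rfl
      · simp [hx, Ne.symm hx]
  · rw [integral, map_smul, map_sum]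
    simp [counit_p]

end Bismash

namespace MatchedPair

open scoped Classical

open Representation

variable {𝕜 : Type*} [Field 𝕜] {F G : Type*} [Group F] [Group G] (M : MatchedPair F G) (x : G)
  {V : Type*} [AddCommGroup V] [Module 𝕜 V] (ρ : Representation 𝕜 (M.stab x) V)

/-- The space `V̂ = 𝕜F ⊗_{𝕜F_x} V` of the `F`-representation induced from the `F_x`-module `V`. -/
abbrev Hat : Type _ := IndV (M.stab x).subtype ρ

/-- The pure tensor `b ⊗ v` in `𝕜F ⊗_{𝕜F_x} V`. -/
def tens (b : F) : V →ₗ[𝕜] M.Hat x ρ := IndV.mk (M.stab x).subtype ρ b⁻¹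

theorem tens_mul (b : F) (f : M.stab x) (v : V) :
    M.tens x ρ (b * f) v = M.tens x ρ b (ρ f v) := by
  have := Coinvariants.mk_self_apply
    (Representation.tprod ((leftRegular 𝕜 F).comp (M.stab x).subtype) ρ) f
    ((MonoidAlgebra.single (b * f)⁻¹ (1 : 𝕜)) ⊗ₜ[𝕜] v)
  refine this.symm.trans ?_
  simp [tens]

theorem ind_tens (a b : F) (v : V) :
    Representation.ind (M.stab x).subtype ρ a (M.tens x ρ b v) = M.tens x ρ (a * b) v := by
  rw [tens, Representation.ind_mk, tens, mul_inv_rev]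

/-- The action of `p_y # 1` on `V̂`: it maps `b ⊗ v` to `δ_{y ◁ b, x} (b ⊗ v)`. -/
def hatProj (y : G) : M.Hat x ρ →ₗ[𝕜] M.Hat x ρ :=
  Coinvariants.map _ _ ⟨(Finsupp.linearCombination 𝕜 (fun h : F =>
      if M.ract y h⁻¹ = x then MonoidAlgebra.single h (1 : 𝕜) else 0) ∘ₗ
      (MonoidAlgebra.coeffLinearEquiv 𝕜).toLinearMap).rTensor V, fun g => by
    have hg : ∀ h : F, M.ract y (h⁻¹ * (g : F)⁻¹) = x ↔ M.ract y h⁻¹ = x := fun h => by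
      rw [M.ract_mul, ← Bismash.eq_ract_inv_iff, inv_inv]
      have : M.ract x g = x := g.2
      rw [this]
    refine TensorProduct.ext (MonoidAlgebra.lhom_ext' fun h => LinearMap.ext_ring ?_)
    ext v
    by_cases hh : M.ract y h⁻¹ = x
    · simp [hg, hh]
    · simp [hg, hh]⟩

theorem hatProj_tens (y : G) (b : F) (v : V) :
    M.hatProj x ρ y (M.tens x ρ b v) = if M.ract y b = x then M.tens x ρ b v else 0 := by
  rw [hatProj, tens]
  by_cases h : M.ract y b = x
  · simp [h]
  · simp [h]

theorem hat_ext {W : Type*} [AddCommGroup W] [Module 𝕜 W] {f g : M.Hat x ρ →ₗ[𝕜] W}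
    (h : ∀ b v, f (M.tens x ρ b v) = g (M.tens x ρ b v)) : f = g :=
  IndV.hom_ext _ _ fun b => LinearMap.ext fun v => by
    have := h b⁻¹ v
    rwa [tens, inv_inv] at this

/-- The `𝕜^G # 𝕜F`-module structure of `V̂`: `(p_y # a)[b ⊗ v] = δ_{y ◁ (ab), x} (ab ⊗ v)`. -/
def hatRep [Fintype G] : Bismash 𝕜 M →ₐ[𝕜] Module.End 𝕜 (M.Hat x ρ) :=
  AlgHom.ofLinearMap
    (Bismash.lin fun y a => M.hatProj x ρ y ∘ₗ Representation.ind (M.stab x).subtype ρ a)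
    (by
      rw [Bismash.one_def, map_sum]
      refine M.hat_ext x ρ fun b v => ?_
      simp only [Bismash.lin_p, LinearMap.sum_apply, LinearMap.comp_apply, ind_tens, hatProj_tens,
        one_mul, ← Bismash.eq_ract_inv_iff]
      simp)
    (fun u v => by
      induction u using Bismash.induct with
      | hadd u u' hu hu' => simp only [add_mul, map_add]; rw [hu, hu']
      | hsmul c u hu => simp only [smul_mul_assoc, map_smul]; rw [hu]
      | hp y a =>
      induction v using Bismash.induct with
      | hadd u u' hu hu' => simp only [mul_add, map_add]; rw [hu, hu']
      | hsmul c u hu => simp only [mul_smul_comm, map_smul]; rw [hu]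
      | hp z c =>
      rw [Bismash.p_mul_p]
      refine M.hat_ext x ρ fun b v => ?_
      rw [Module.End.mul_apply, Bismash.lin_p, Bismash.lin_p, LinearMap.comp_apply,
        LinearMap.comp_apply, ind_tens, hatProj_tens]
      by_cases h : M.ract y a = z
      · subst h
        rw [if_pos rfl, Bismash.lin_p, LinearMap.comp_apply, ind_tens, hatProj_tens, mul_assoc,
          M.ract_mul]
        split_ifs with h2
        · rw [ind_tens, hatProj_tens, M.ract_mul, if_pos h2]
        · rw [map_zero, map_zero]
      · rw [if_neg h, map_zero, LinearMap.zero_apply]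
        split_ifs with h2
        · rw [ind_tens, hatProj_tens, M.ract_mul, if_neg]
          intro h3
          apply h
          rw [← Bismash.eq_ract_inv_iff] at h2 h3
          rw [h2, h3]
        · rw [map_zero, map_zero])

theorem hatRep_apply [Fintype G] (y : G) (a b : F) (v : V) :
    M.hatRep x ρ (Bismash.p 𝕜 M y a) (M.tens x ρ b v)
      = if M.ract y (a * b) = x then M.tens x ρ (a * b) v else 0 := by
  rw [hatRep, AlgHom.ofLinearMap_apply, Bismash.lin_p, LinearMap.comp_apply, ind_tens, hatProj_tens]

/-- `O` is a null indicator orbit for `H = 𝕜^G # 𝕜F`: `O` is the `F`-orbit `𝒪_x` of some `x ∈ G`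
such that, for every irreducible `F_x`-module `V`, the induced `H`-module `V̂` has indicator `0`.
(Irreducible representations of a finite group are finite-dimensional, so up to isomorphism they
all have underlying space `V` in the universe of `𝕜`.) -/
def IsNullIndicatorOrbit (𝕜 : Type u) [Field 𝕜] {F G : Type*} [Group F] [Group G] [Finite F]
    [Finite G] (M : MatchedPair F G) (O : Set G) : Prop :=
  letI := Fintype.ofFinite F
  letI := Fintype.ofFinite G
  ∃ x : G, O = M.orbit x ∧
    ∀ (V : Type u) [AddCommGroup V] [Module 𝕜 V] [FiniteDimensional 𝕜 V]
      (ρ : Representation 𝕜 (M.stab x) V), ρ.IsIrreducible →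
        schurIndicator (Bismash.integral 𝕜 M) (M.hatRep x ρ) = 0

end MatchedPair

end Indicators

/-- The symmetric group `S_n` on `n` points, with products read from left to right. -/
abbrev SymGroup (n : ℕ) : Type := (Equiv.Perm (Fin n))ᵐᵒᵖ

namespace SymGroup

variable {n : ℕ}

instance : Finite (SymGroup n) := Finite.of_injective MulOpposite.unop MulOpposite.unop_injective

/-- The image `x^g` of the point `x` under `g`. -/
def act (x : Fin n) (g : SymGroup n) : Fin n := g.unop x

theorem act_mul (x : Fin n) (g h : SymGroup n) : act x (g * h) = act (act x g) h := rfl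

/-- `G ≤ S_n` is sharply `k`-transitive: for any two `k`-tuples of distinct points there is a
unique element of `G` that maps the first to the second. -/
def SharplyTransitive (k : ℕ) (G : Subgroup (SymGroup n)) : Prop :=
  ∀ x y : Fin k ↪ Fin n, ∃! g : G, ∀ i, act (x i) g = y i

/-- `S_{n-k}` as the subgroup of `S_n` that fixes each of the last `k` points. (The points
`1, …, n` are numbered `0, …, n - 1` here.) -/
def fixLast (n k : ℕ) : Subgroup (SymGroup n) where
  carrier := {g | ∀ x : Fin n, n - k ≤ (x : ℕ) → act x g = x}
  one_mem' := fun _ _ => rfl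
  mul_mem' {a b} ha hb := fun x hx => by rw [act_mul, ha x hx, hb x hx]
  inv_mem' {a} ha := fun x hx => by
    have h : act x a = x := ha x hx
    calc act x a⁻¹ = act (act x a) a⁻¹ := by rw [h]
      _ = x := by rw [← act_mul, mul_inv_cancel]; rfl

variable {k : ℕ} (hk : k ≤ n) {G : Subgroup (SymGroup n)}

/-- The tuple `[α_1, …, α_k]` attached to `g ∈ G`: `α_i = (n - k + i)^g`. -/
def alpha (g : G) (i : Fin k) : Fin n :=
  act ⟨n - k + i, by have := i.isLt; omega⟩ g

/-- The `Γ`-indices of `g`: `I(g) = {i | α_i ∈ Γ}`, where `Γ` is the set of the first `n - k`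
points. -/
def gammaIndices (g : G) : Set (Fin k) := {i | (alpha hk g i : ℕ) < n - k}

/-- The member `ℳ_{I,D} = {g ∈ G | I(g) = I, D(g) = D}`, where `D(g) = [α_j]`, `j ∉ I(g)`. -/
def member (I : Finset (Fin k)) (D : {j : Fin k // j ∉ I} → Fin n) : Set G :=
  {g | gammaIndices hk g = I ∧ ∀ j, alpha hk g j.1 = D j}

/-- The `m`-family `{ℳ_{I,D} : |I| = m}`, where `I ⊆ {1, …, k}` and `D` is a tuple of `k - |I|`
distinct elements of the set `Δ` of the last `k` points, indexed by the `j ∉ I`. -/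
def family (G : Subgroup (SymGroup n)) (m : ℕ) : Set (Set G) :=
  {S | ∃ (I : Finset (Fin k)) (D : {j : Fin k // j ∉ I} → Fin n), I.card = m ∧
    Function.Injective D ∧ (∀ j, n - k ≤ (D j : ℕ)) ∧ S = member hk I D}

end SymGroup

/-- The number `i_j` of `σ ∈ S_j` with `σ² = 1`. -/
noncomputable def numInvolutions (j : ℕ) : ℕ := Nat.card {σ : Equiv.Perm (Fin j) // σ ^ 2 = 1}

theorem numInvolutions_zero : numInvolutions 0 = 1 := by
  rw [numInvolutions, Nat.card_eq_one_iff_unique]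
  exact ⟨inferInstance, ⟨⟨1, one_pow 2⟩⟩⟩

/-! Two facts combine. The algebraic one (`isNullIndicatorOrbit_orbit_iff`) holds for every matched
pair of finite groups in characteristic 0: an orbit is null exactly when it does not contain the
inverse of its base point. In `∑ Λ₁ Λ₂` only the terms with `(y ◁ a)⁻¹ = y` survive, and such a term
acts on `V̂` as zero unless `y` and `y⁻¹` both lie in `𝒪_x`. Inversion permutes the orbits, so if
`x⁻¹ ∉ 𝒪_x` every indicator vanishes. If `x⁻¹ ∈ 𝒪_x`, the trivial `F_x`-module has nonzero
indicator: its induced module has a basis indexed by the orbit, on which all the traces are natural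
numbers, and one of them is positive.

The combinatorial one: `g ↦ (α_1, …, α_k)` identifies `G` with the injective `k`-tuples, and `F`
acts entrywise, fixing `Δ` and permuting `Γ` arbitrarily. Hence the orbits are the nonempty members.
A member records a partial injection of `{1, …, k}` with domain the complement of `I`; passing to
`g⁻¹` inverts it (`inv_mem_orbit_iff`). So the member is not null exactly when the partial injection
is its own inverse, that is, an involution or the identity on the complement of `I`. There are
`k.choose m` sets `I`, each with `i_{k-m}` such permutations. -/

theorem isIrreducible_trivial_self (𝕜 A : Type*) [Field 𝕜] [Monoid A] :
    (Representation.trivial 𝕜 A 𝕜).IsIrreducible where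
  exists_pair_ne := ⟨⊥, ⊤, fun h => bot_ne_top (α := Submodule 𝕜 𝕜)
    (congrArg Subrepresentation.toSubmodule h)⟩
  eq_bot_or_eq_top N := (eq_bot_or_eq_top N.toSubmodule).imp
    (fun h => Subrepresentation.toSubmodule_injective h)
    (fun h => Subrepresentation.toSubmodule_injective h)

/-! ### Orbits of a matched pair and inversion -/

namespace MatchedPair

section Orbits

variable {F G : Type*} [Group F] [Group G] (M : MatchedPair F G)

theorem ract_ract_inv (x : G) (a : F) : M.ract (M.ract x a) a⁻¹ = x := by
  rw [← M.ract_mul, mul_inv_cancel, M.ract_one]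

theorem ract_inv_ract (x : G) (a : F) : M.ract (M.ract x a⁻¹) a = x := by
  rw [← M.ract_mul, inv_mul_cancel, M.ract_one]

theorem mem_orbit_self (x : G) : x ∈ M.orbit x := ⟨1, M.ract_one x⟩

theorem mem_orbit_iff {x y : G} : y ∈ M.orbit x ↔ ∃ b, M.ract y b = x := by
  constructor
  · rintro ⟨a, rfl⟩
    exact ⟨a⁻¹, M.ract_ract_inv x a⟩
  · rintro ⟨b, rfl⟩
    exact ⟨b⁻¹, M.ract_ract_inv y b⟩

theorem orbit_eq_of_mem {x y : G} (h : y ∈ M.orbit x) : M.orbit y = M.orbit x := by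
  obtain ⟨a, rfl⟩ := h
  ext z
  constructor
  · rintro ⟨b, rfl⟩
    exact ⟨a * b, M.ract_mul x a b⟩
  · rintro ⟨b, rfl⟩
    exact ⟨a⁻¹ * b, by simp only [M.ract_mul, M.ract_ract_inv]⟩

theorem inv_ract (x : G) (a : F) : (M.ract x a)⁻¹ = M.ract x⁻¹ (M.lact x a) := by
  have h := M.ract_mul_inv 1 x a
  rw [one_mul, M.one_ract, one_mul] at h
  exact h.symm

/-- By `inv_ract`, inversion maps orbits into orbits, so whether an orbit is closed under inversion
can be tested at any one of its points. -/
theorem inv_mem_orbit_of_mem {x y : G} (hy : y ∈ M.orbit x) (hy' : y⁻¹ ∈ M.orbit x) :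
    x⁻¹ ∈ M.orbit x := by
  obtain ⟨b, rfl⟩ := M.mem_orbit_iff.mp hy
  rw [M.inv_ract, ← M.orbit_eq_of_mem hy']
  exact ⟨_, rfl⟩

end Orbits

/-! ### Vanishing of indicators -/

open scoped Classical

/-- The legs `p_{y⁻¹} # (y ▷ a)` and `p_y # a` of the coproduct have nonzero product only if `y⁻¹ ◁
(y ▷ a) = y`, and the left side is `(y ◁ a)⁻¹` by `inv_ract`. -/
theorem mul'_comul_integral {𝕜 : Type*} [Field 𝕜] {F G : Type*} [Group F] [Group G] [Fintype F]
    [Fintype G] (M : MatchedPair F G) :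
    LinearMap.mul' 𝕜 (Bismash 𝕜 M) (Coalgebra.comul (R := 𝕜) (Bismash.integral 𝕜 M))
      = (Fintype.card F : 𝕜)⁻¹ • ∑ a : F, ∑ y : G,
        if (M.ract y a)⁻¹ = y then Bismash.p 𝕜 M y⁻¹ (M.lact y a * a) else 0 := by
  simp only [Bismash.integral, map_smul, map_sum, Bismash.comul_p, LinearMap.mul'_apply,
    Bismash.p_mul_p, one_mul, M.inv_ract]

/-- Each term of `∑ Λ₁ Λ₂` acts as the zero operator, so no trace has to be computed: a term not
killing some `b ⊗ v` would put `y⁻¹`, and with it `y`, in the orbit of `x`. -/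
theorem schurIndicator_hatRep_eq_zero {𝕜 : Type*} [Field 𝕜] {F G : Type*} [Group F] [Group G]
    [Fintype F] [Fintype G] (M : MatchedPair F G) {x : G} (hx : x⁻¹ ∉ M.orbit x)
    {V : Type*} [AddCommGroup V] [Module 𝕜 V] (ρ : Representation 𝕜 (M.stab x) V) :
    schurIndicator (Bismash.integral 𝕜 M) (M.hatRep x ρ) = 0 := by
  rw [schurIndicator, mul'_comul_integral, map_smul, map_sum]
  rw [Finset.sum_eq_zero, smul_zero, map_zero]
  intro a _
  rw [map_sum]
  refine Finset.sum_eq_zero fun y _ => ?_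
  split_ifs with h
  · refine M.hat_ext x ρ fun b v => ?_
    rw [hatRep_apply, if_neg, LinearMap.zero_apply]
    intro hb
    have h1 : y⁻¹ ∈ M.orbit x := M.mem_orbit_iff.mpr ⟨_, hb⟩
    refine hx (M.inv_mem_orbit_of_mem ?_ h1)
    rw [← M.orbit_eq_of_mem h1, M.mem_orbit_iff]
    exact ⟨a, by rw [← h, inv_inv, h]⟩
  · rw [map_zero]

/-! ### The module induced from the trivial representation -/

section Trivial

variable (𝕜 : Type*) [Field 𝕜] {F G : Type*} [Group F] [Group G] (M : MatchedPair F G) (x : G)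

/-- An element of `F` that moves a point `z` of the orbit of `x` to `x`. -/
noncomputable def toBase (z : M.orbit x) : F := (M.mem_orbit_iff.mp z.2).choose

theorem ract_toBase (z : M.orbit x) : M.ract z (M.toBase x z) = x :=
  (M.mem_orbit_iff.mp z.2).choose_spec

/-- Since `c⁻¹ b` lies in `F_x`, it crosses the tensor sign and acts trivially. Thus `b ⊗ v` depends
on `b` only through the point `x ◁ b⁻¹`. -/
theorem tens_trivial_eq {b c : F} {z : G} (hb : M.ract z b = x) (hc : M.ract z c = x) (v : 𝕜) :
    M.tens x (Representation.trivial 𝕜 (M.stab x) 𝕜) b v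
      = M.tens x (Representation.trivial 𝕜 (M.stab x) 𝕜) c v := by
  have hs : c⁻¹ * b ∈ M.stab x := by
    change M.ract x (c⁻¹ * b) = x
    rw [← hc, M.ract_mul, M.ract_ract_inv, hb, hc]
  have := M.tens_mul x (Representation.trivial 𝕜 (M.stab x) 𝕜) c ⟨_, hs⟩ v
  simpa using this

/-- The linear map from the module induced from the trivial representation of `F_x` to the
functions on the orbit of `x` that maps `b ⊗ v` to `v` times the indicator function of
`x ◁ b⁻¹`. -/
noncomputable def trivialHatToFun :
    M.Hat x (Representation.trivial 𝕜 (M.stab x) 𝕜) →ₗ[𝕜] (M.orbit x → 𝕜) :=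
  Representation.Coinvariants.lift _ (TensorProduct.lift
    ((Finsupp.linearCombination 𝕜 fun h : F => LinearMap.pi fun z : M.orbit x =>
      if M.ract z h⁻¹ = x then (LinearMap.id : 𝕜 →ₗ[𝕜] 𝕜) else 0) ∘ₗ
      (MonoidAlgebra.coeffLinearEquiv 𝕜).toLinearMap)) fun g => by
    -- The index `h` is `b⁻¹`, because `tens` places `b ⊗ v` at `b⁻¹`. Invariance under `F_x` makes
    -- the map descend to the coinvariants.
    have hg : ∀ (y : G) (h : F), M.ract y (h⁻¹ * (g : F)⁻¹) = x ↔ M.ract y h⁻¹ = x := fun y h => by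
      rw [M.ract_mul, ← Bismash.eq_ract_inv_iff, inv_inv]
      have : M.ract x g = x := g.2
      rw [this]
    refine TensorProduct.ext (MonoidAlgebra.lhom_ext' fun h => LinearMap.ext_ring ?_)
    ext z
    simp [hg]

theorem trivialHatToFun_tens (b : F) (v : 𝕜) (z : M.orbit x) :
    M.trivialHatToFun 𝕜 x (M.tens x _ b v) z = if M.ract z b = x then v else 0 := by
  rw [trivialHatToFun, tens]
  by_cases h : M.ract z b = x
  · simp [h]
  · simp [h]

/-- The module induced from the trivial representation of `F_x` has a basis indexed by the orbit
of `x`. -/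
noncomputable def trivialHatBasis [Finite G] :
    Module.Basis (M.orbit x) 𝕜 (M.Hat x (Representation.trivial 𝕜 (M.stab x) 𝕜)) :=
  haveI := Fintype.ofFinite (M.orbit x)
  Module.Basis.ofEquivFun (LinearEquiv.ofLinearMap (M.trivialHatToFun 𝕜 x)
    (Fintype.linearCombination 𝕜 fun z : M.orbit x => M.tens x _ (M.toBase x z) (1 : 𝕜))
    (by
      refine LinearMap.ext fun f => funext fun z => ?_
      -- Elements of `F` act injectively, so `z` and `w` sent to `x` by the same element coincide.
      have e : ∀ w : M.orbit x, M.ract z (M.toBase x w) = x ↔ z = w := fun w => by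
        refine ⟨fun h => Subtype.ext ?_, fun h => h ▸ M.ract_toBase x z⟩
        exact (M.ract_ract_inv z (M.toBase x w)).symm.trans
          ((congrArg (M.ract · (M.toBase x w)⁻¹) (h.trans (M.ract_toBase x w).symm)).trans
            (M.ract_ract_inv w (M.toBase x w)))
      simp [Fintype.linearCombination_apply, trivialHatToFun_tens, e])
    (by
      refine M.hat_ext x _ fun b v => ?_
      have e : ∀ w : M.orbit x, M.ract w b = x ↔ w = ⟨M.ract x b⁻¹, ⟨_, rfl⟩⟩ := fun w => by
        rw [Subtype.ext_iff, Bismash.eq_ract_inv_iff]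
      simp only [LinearMap.comp_apply, Fintype.linearCombination_apply, trivialHatToFun_tens, e,
        ite_smul, zero_smul, Finset.sum_ite_eq', Finset.mem_univ, if_true, LinearMap.id_apply]
      rw [← map_smul, smul_eq_mul, mul_one]
      exact M.tens_trivial_eq 𝕜 x (M.ract_toBase x _) (M.ract_inv_ract x b) v))

theorem trivialHatBasis_repr [Finite G] (u) (z : M.orbit x) :
    (M.trivialHatBasis 𝕜 x).repr u z = M.trivialHatToFun 𝕜 x u z := by
  rw [trivialHatBasis, Module.Basis.ofEquivFun_repr_apply]
  rfl

theorem trivialHatBasis_apply [Finite G] (z : M.orbit x) :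
    M.trivialHatBasis 𝕜 x z = M.tens x _ (M.toBase x z) 1 := by
  rw [trivialHatBasis, Module.Basis.coe_ofEquivFun]
  simp

/-- In the orbit basis the diagonal entries of `p_y # c` are 0 or 1, so `|F|` times the indicator is
the image of a natural number. Nothing can cancel in characteristic 0, and a single positive term
suffices. -/
theorem schurIndicator_hatRep_trivial_ne_zero [CharZero 𝕜] [Fintype F] [Fintype G]
    (hx : x⁻¹ ∈ M.orbit x) :
    schurIndicator (Bismash.integral 𝕜 M)
      (M.hatRep x (Representation.trivial 𝕜 (M.stab x) 𝕜)) ≠ 0 := by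
  have := Fintype.ofFinite (M.orbit x)
  have key : ∀ (y : G) (c : F), LinearMap.trace 𝕜 _
      (M.hatRep x (Representation.trivial 𝕜 (M.stab x) 𝕜) (Bismash.p 𝕜 M y c))
      = ((∑ w : M.orbit x, if M.ract y (c * M.toBase x w) = x ∧
          M.ract w (c * M.toBase x w) = x then 1 else 0 : ℕ) : 𝕜) := by
    intro y c
    rw [LinearMap.trace_eq_matrix_trace 𝕜 (M.trivialHatBasis 𝕜 x), Matrix.trace, Nat.cast_sum]
    refine Finset.sum_congr rfl fun w _ => ?_
    rw [Matrix.diag_apply, LinearMap.toMatrix_apply, trivialHatBasis_repr, trivialHatBasis_apply,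
      hatRep_apply]
    by_cases h : M.ract y (c * M.toBase x w) = x
    · simp [h, trivialHatToFun_tens]
    · simp [h]
  rw [schurIndicator, mul'_comul_integral, map_smul, map_smul, smul_eq_mul]
  refine mul_ne_zero (inv_ne_zero (Nat.cast_ne_zero.mpr Fintype.card_ne_zero)) ?_
  have e : ∀ (a : F) (y : G), LinearMap.trace 𝕜 _
      (M.hatRep x (Representation.trivial 𝕜 (M.stab x) 𝕜)
        (if (M.ract y a)⁻¹ = y then Bismash.p 𝕜 M y⁻¹ (M.lact y a * a) else 0))
      = ((if (M.ract y a)⁻¹ = y then ∑ w : M.orbit x,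
          if M.ract y⁻¹ (M.lact y a * a * M.toBase x w) = x ∧
          M.ract w (M.lact y a * a * M.toBase x w) = x then 1 else 0 else 0 : ℕ) : 𝕜) := by
    intro a y
    split_ifs
    · exact key _ _
    · simp
  simp only [map_sum, e, ← Nat.cast_sum]
  rw [Nat.cast_ne_zero]
  intro h
  obtain ⟨a, ha⟩ := hx
  have ha : M.ract x a = x⁻¹ := ha
  have h1 := Finset.sum_eq_zero_iff.mp (Finset.sum_eq_zero_iff.mp h a (Finset.mem_univ _)) x
    (Finset.mem_univ _)
  rw [if_pos (by rw [ha, inv_inv])] at h1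
  -- The positive term has `y = x`, `x ◁ a = x⁻¹` and basis point `w = x⁻¹`. As `w = y⁻¹`, its two
  -- conditions coincide: `(x ▷ a) a` maps `x⁻¹` to `x` and back to `x⁻¹`, which `toBase` moves to
  -- `x`.
  have h2 := Finset.sum_eq_zero_iff.mp h1 ⟨x⁻¹, a, ha⟩ (Finset.mem_univ _)
  have h3 : M.ract x⁻¹ (M.lact x a * a * M.toBase x ⟨x⁻¹, a, ha⟩) = x := by
    rw [M.ract_mul, M.ract_mul, ← M.inv_ract, ha, inv_inv, ha]
    exact M.ract_toBase x ⟨x⁻¹, a, ha⟩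
  rw [if_pos ⟨h3, h3⟩] at h2
  exact one_ne_zero h2

end Trivial

/-- The orbit of `x` is a null indicator orbit if and only if it does not contain `x⁻¹`. -/
theorem isNullIndicatorOrbit_orbit_iff (𝕜 : Type u) [Field 𝕜] [CharZero 𝕜] {F G : Type*} [Group F]
    [Group G] [Finite F] [Finite G] (M : MatchedPair F G) (x : G) :
    M.IsNullIndicatorOrbit 𝕜 (M.orbit x) ↔ x⁻¹ ∉ M.orbit x := by
  let := Fintype.ofFinite F
  let := Fintype.ofFinite G
  constructor
  · rintro ⟨y, hy, h⟩ hx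
    rw [hy] at hx
    -- The base point `y` witnessing nullity may differ from `x`, so closure under inversion is
    -- carried over to `y`.
    have hy' : y⁻¹ ∈ M.orbit y := M.inv_mem_orbit_of_mem (hy ▸ M.mem_orbit_self x) hx
    refine M.schurIndicator_hatRep_trivial_ne_zero 𝕜 y hy' (h 𝕜 _ ?_)
    exact isIrreducible_trivial_self 𝕜 _
  · exact fun hx => ⟨x, rfl, fun V _ _ _ ρ _ => M.schurIndicator_hatRep_eq_zero hx ρ⟩

end MatchedPair

/-! ### Tuples, orbits and members for a sharply transitive group -/

namespace SymGroup

variable {n k : ℕ} (hk : k ≤ n) {G : Subgroup (SymGroup n)}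

/-- The `j`-th of the last `k` points. -/
def lastPoint (j : Fin k) : Fin n := ⟨n - k + j, by have := j.isLt; omega⟩

theorem lastPoint_injective : Function.Injective (lastPoint hk) := by
  intro i j h
  have := congrArg Fin.val h
  simp only [lastPoint] at this
  exact Fin.ext (by omega)

theorem le_lastPoint (j : Fin k) : n - k ≤ (lastPoint hk j : ℕ) := Nat.le_add_right _ _

theorem exists_lastPoint_eq {x : Fin n} (hx : n - k ≤ (x : ℕ)) : ∃ j, lastPoint hk j = x :=
  ⟨⟨x - (n - k), by have := x.isLt; omega⟩, Fin.ext (by simp only [lastPoint]; omega)⟩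

theorem act_injective (g : SymGroup n) : Function.Injective fun x => act x g :=
  g.unop.injective

theorem alpha_injective (g : G) : Function.Injective (alpha hk g) :=
  (act_injective (g : SymGroup n)).comp (lastPoint_injective hk)

theorem act_eq_iff_act_inv_eq {x y : Fin n} {g : SymGroup n} : act x g = y ↔ act y g⁻¹ = x := by
  constructor
  · rintro rfl
    rw [← act_mul, mul_inv_cancel]; rfl
  · rintro rfl
    rw [← act_mul, inv_mul_cancel]; rfl

theorem alpha_eq_lastPoint_iff {g : G} {i j : Fin k} :
    alpha hk g i = lastPoint hk j ↔ alpha hk g⁻¹ j = lastPoint hk i :=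
  act_eq_iff_act_inv_eq

theorem act_lt_iff {f : SymGroup n} (hf : f ∈ fixLast n k) (x : Fin n) :
    (act x f : ℕ) < n - k ↔ (x : ℕ) < n - k := by
  constructor
  · intro h
    by_contra hx
    rw [hf x (not_lt.mp hx)] at h
    exact hx h
  · intro h
    by_contra hx
    have : act x f = x := act_injective f (hf _ (not_lt.mp hx))
    rw [this] at hx
    exact hx h

/-- Apply `g f = (g ▷ f)(g ◁ f)` to a point of `Δ`: the factor `g ▷ f` lies in `F` and fixes it. -/
theorem alpha_ract (hFG : Subgroup.IsComplement' (fixLast n k) G) (g : G) (f : fixLast n k)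
    (i : Fin k) : alpha hk ((exactMatchedPair hFG).ract g f) i = act (alpha hk g i) f := by
  have h := congrArg (act (lastPoint hk i)) (exactMatchedPair_spec hFG g f)
  rw [act_mul, act_mul, ((exactMatchedPair hFG).lact g f).2 _ (le_lastPoint hk i)] at h
  exact h.symm

theorem SharplyTransitive.eq_of_alpha_eq (hG : SharplyTransitive k G) {g h : G}
    (e : ∀ i, alpha hk g i = alpha hk h i) : g = h :=
  (hG ⟨lastPoint hk, lastPoint_injective hk⟩ ⟨alpha hk h, alpha_injective hk h⟩).unique e
    fun _ => rfl

theorem SharplyTransitive.exists_alpha_eq (hG : SharplyTransitive k G) {y : Fin k → Fin n}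
    (hy : Function.Injective y) : ∃ g : G, ∀ i, alpha hk g i = y i :=
  (hG ⟨lastPoint hk, lastPoint_injective hk⟩ ⟨y, hy⟩).exists

/-- Two tuples of distinct points whose entries agree or both lie outside the last `k` points
differ by a permutation that fixes the last `k` points. -/
theorem exists_mem_fixLast {y z : Fin k → Fin n} (hy : Function.Injective y)
    (hz : Function.Injective z)
    (h : ∀ i, z i = y i ∨ ((z i : ℕ) < n - k ∧ (y i : ℕ) < n - k)) :
    ∃ f ∈ fixLast n k, ∀ i, act (y i) f = z i := by
  classical
  -- `φ` need not be injective on all points, only on `Δ` together with the entries of `y`; its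
  -- restriction to that set is then extended to a permutation.
  let φ : Fin n → Fin n := fun x => if hx : ∃ i, y i = x then z hx.choose else x
  have hφ : ∀ i, φ (y i) = z i := fun i => by
    have hx : ∃ j, y j = y i := ⟨i, rfl⟩
    simp only [φ, dif_pos hx]
    rw [hy hx.choose_spec]
  have hφ' : ∀ x : Fin n, n - k ≤ (x : ℕ) → φ x = x := fun x hx => by
    by_cases hi : ∃ i, y i = x
    · obtain ⟨i, rfl⟩ := hi
      rw [hφ]
      rcases h i with e | ⟨_, e⟩
      · exact e
      · omega
    · simp only [φ, dif_neg hi]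
  have hz' : ∀ i, n - k ≤ (z i : ℕ) → z i = y i := fun i hi => by
    rcases h i with e | ⟨e, _⟩
    · exact e
    · omega
  have hinj : Set.InjOn φ {x | n - k ≤ (x : ℕ) ∨ ∃ i, y i = x} := by
    rintro a (ha | ⟨i, rfl⟩) b (hb | ⟨j, rfl⟩) hab
    · rwa [hφ' a ha, hφ' b hb] at hab
    · rw [hφ' a ha, hφ] at hab
      rw [hab, hz' j (hab ▸ ha)]
    · rw [hφ' b hb, hφ] at hab
      rw [← hab, hz' i (hab ▸ hb)]
    · rw [hφ, hφ] at hab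
      rw [hz hab]
  obtain ⟨g, hg⟩ := Set.MapsTo.exists_equiv_extend_of_card_eq (t := Finset.univ)
    (by rw [Finset.card_univ]) (fun _ _ => by simp) hinj
  let σ : Equiv.Perm (Fin n) := g.trans (Equiv.subtypeUnivEquiv fun x => Finset.mem_univ x)
  have hσ : ∀ x : Fin n, n - k ≤ (x : ℕ) ∨ (∃ i, y i = x) → σ x = φ x := fun x hx => hg x hx
  refine ⟨MulOpposite.op σ, fun x hx => ?_, fun i => ?_⟩
  · exact (hσ x (Or.inl hx)).trans (hφ' x hx)
  · exact (hσ _ (Or.inr ⟨i, rfl⟩)).trans (hφ i)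

theorem mem_orbit_iff_alpha (hG : SharplyTransitive k G)
    (hFG : Subgroup.IsComplement' (fixLast n k) G) {x y : G} :
    y ∈ (exactMatchedPair hFG).orbit x ↔
      ∀ i, alpha hk y i = alpha hk x i ∨
        ((alpha hk y i : ℕ) < n - k ∧ (alpha hk x i : ℕ) < n - k) := by
  constructor
  · rintro ⟨f, rfl⟩ i
    simp only [alpha_ract]
    rcases lt_or_ge (alpha hk x i : ℕ) (n - k) with h | h
    · exact Or.inr ⟨(act_lt_iff f.2 _).mpr h, h⟩
    · exact Or.inl (f.2 _ h)
  · intro h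
    obtain ⟨f, hf, hf'⟩ := exists_mem_fixLast (alpha_injective hk x) (alpha_injective hk y) h
    exact ⟨⟨f, hf⟩, hG.eq_of_alpha_eq hk fun i => by rw [alpha_ract]; exact hf' i⟩

/-- With all `D j` in `Δ`, no index outside `I` can be a `Γ`-index, so one inclusion of `I(g) = I`
is automatic. -/
theorem mem_member_iff {I : Finset (Fin k)} {D : {j : Fin k // j ∉ I} → Fin n}
    (hD : ∀ j, n - k ≤ (D j : ℕ)) {g : G} :
    g ∈ member hk I D ↔ (∀ i ∈ I, (alpha hk g i : ℕ) < n - k) ∧ ∀ j, alpha hk g j.1 = D j := by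
  constructor
  · rintro ⟨h, h'⟩
    refine ⟨fun i hi => ?_, h'⟩
    have : i ∈ gammaIndices hk g := by rw [h]; exact hi
    exact this
  · rintro ⟨h, h'⟩
    refine ⟨Set.ext fun i => ⟨fun hi => ?_, fun hi => h i hi⟩, h'⟩
    by_contra hi'
    have := hD ⟨i, hi'⟩
    rw [← h' ⟨i, hi'⟩] at this
    exact absurd hi (not_lt.mpr this)

theorem orbit_eq_member (hG : SharplyTransitive k G)
    (hFG : Subgroup.IsComplement' (fixLast n k) G) {I : Finset (Fin k)}
    {D : {j : Fin k // j ∉ I} → Fin n} (hD : ∀ j, n - k ≤ (D j : ℕ)) {x : G}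
    (hx : x ∈ member hk I D) : (exactMatchedPair hFG).orbit x = member hk I D := by
  rw [mem_member_iff hk hD] at hx
  ext y
  rw [mem_orbit_iff_alpha hk hG, mem_member_iff hk hD]
  constructor
  · refine fun h => ⟨fun i hi => ?_, fun j => ?_⟩
    · rcases h i with e | e
      · rw [e]; exact hx.1 i hi
      · exact e.1
    · rcases h j with e | e
      · rw [e, hx.2]
      · have := hD j
        rw [← hx.2 j] at this
        exact absurd e.2 (not_lt.mpr this)
  · intro h i
    by_cases hi : i ∈ I
    · exact Or.inr ⟨h.1 i hi, hx.1 i hi⟩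
    · exact Or.inl ((h.2 ⟨i, hi⟩).trans (hx.2 ⟨i, hi⟩).symm)

/-- The bound on `I.card` leaves room for distinct points of `Γ` at the indices in `I`; transitivity
realizes the completed tuple. -/
theorem member_nonempty (hG : SharplyTransitive k G) {I : Finset (Fin k)}
    {D : {j : Fin k // j ∉ I} → Fin n} (hI : I.card ≤ n - k) (hDi : Function.Injective D)
    (hD : ∀ j, n - k ≤ (D j : ℕ)) : (member (G := G) hk I D).Nonempty := by
  obtain ⟨e⟩ : Nonempty (I ↪ Fin (n - k)) :=
    Function.Embedding.nonempty_of_card_le (by simpa using hI)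
  let y : Fin k → Fin n := fun i => if h : i ∈ I then (e ⟨i, h⟩).castLE (Nat.sub_le n k)
    else D ⟨i, h⟩
  have hy : ∀ i (h : i ∈ I), y i = (e ⟨i, h⟩).castLE (Nat.sub_le n k) := fun i h => dif_pos h
  have hy' : ∀ i (h : i ∉ I), y i = D ⟨i, h⟩ := fun i h => dif_neg h
  have hlt : ∀ i ∈ I, (y i : ℕ) < n - k := fun i h => by
    rw [hy i h]; exact (e ⟨i, h⟩).2
  have hge : ∀ i ∉ I, n - k ≤ (y i : ℕ) := fun i h => by
    rw [hy' i h]; exact hD _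
  have hinj : Function.Injective y := by
    intro i j hij
    by_cases hi : i ∈ I <;> by_cases hj : j ∈ I
    · rw [hy i hi, hy j hj] at hij
      simpa using e.injective (Fin.castLE_injective _ hij)
    · exact absurd (hij ▸ hlt i hi) (not_lt.mpr (hge j hj))
    · exact absurd (hij ▸ hlt j hj) (not_lt.mpr (hge i hi))
    · rw [hy' i hi, hy' j hj] at hij
      simpa using hDi hij
  obtain ⟨g, hg⟩ := hG.exists_alpha_eq hk hinj
  refine ⟨g, (mem_member_iff hk hD).mpr ⟨fun i hi => ?_, fun j => ?_⟩⟩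
  · rw [hg]; exact hlt i hi
  · rw [hg, hy' j j.2]

/-- By `alpha_eq_lastPoint_iff`, the partial injection of `x⁻¹` is the inverse of the partial
injection `d` of `x`. The two elements share an orbit exactly when these agree, domains included. -/
theorem inv_mem_orbit_iff (hG : SharplyTransitive k G)
    (hFG : Subgroup.IsComplement' (fixLast n k) G) {I : Finset (Fin k)}
    {d : {j : Fin k // j ∉ I} → Fin k} {x : G}
    (hx : x ∈ member hk I fun j => lastPoint hk (d j)) :
    x⁻¹ ∈ (exactMatchedPair hFG).orbit x ↔ ∀ j, ∃ h : d j ∉ I, d ⟨d j, h⟩ = j := by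
  rw [mem_member_iff hk fun j => le_lastPoint hk _] at hx
  rw [mem_orbit_iff_alpha hk hG]
  constructor
  · intro h j
    have h1 : alpha hk x⁻¹ (d j) = lastPoint hk j := (alpha_eq_lastPoint_iff hk).mp (hx.2 j)
    have h2 : alpha hk x (d j) = lastPoint hk j := by
      rcases h (d j) with e | ⟨e, _⟩
      · rw [← e, h1]
      · rw [h1] at e
        exact absurd e (not_lt.mpr (le_lastPoint hk _))
    have h3 : d j ∉ I := fun hI => by
      have := hx.1 _ hI
      rw [h2] at this
      exact absurd this (not_lt.mpr (le_lastPoint hk _))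
    exact ⟨h3, lastPoint_injective hk ((hx.2 ⟨d j, h3⟩).symm.trans h2)⟩
  · intro h i
    by_cases hi : i ∈ I
    · refine Or.inr ⟨?_, hx.1 i hi⟩
      -- Otherwise `x⁻¹` sends index `i` to some `j`, so `x` sends `j` to `i`; then `j ∉ I` and `d j
      -- = i ∈ I`, although `d` avoids `I`.
      by_contra hlt
      obtain ⟨j, hj⟩ := exists_lastPoint_eq hk (not_lt.mp hlt)
      have h1 : alpha hk x j = lastPoint hk i := by
        rw [alpha_eq_lastPoint_iff]; exact hj.symm
      have hjI : j ∉ I := fun hI => by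
        have := hx.1 j hI
        rw [h1] at this
        exact absurd this (not_lt.mpr (le_lastPoint hk _))
      have h2 : d ⟨j, hjI⟩ = i := lastPoint_injective hk ((hx.2 ⟨j, hjI⟩).symm.trans h1)
      exact (h ⟨j, hjI⟩).1 (h2 ▸ hi)
    · left
      obtain ⟨h1, h2⟩ := h ⟨i, hi⟩
      have h3 := hx.2 ⟨_, h1⟩
      rw [h2, alpha_eq_lastPoint_iff] at h3
      exact h3.trans (hx.2 ⟨i, hi⟩).symm

/-! ### Non-null members and involutions -/

/-- The member attached to a set `I` of indices and a permutation of its complement. -/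
def permMember (G : Subgroup (SymGroup n)) (I : Finset (Fin k))
    (σ : Equiv.Perm {j : Fin k // j ∉ I}) : Set G :=
  member hk I fun j => lastPoint hk (σ j)

theorem permMember_nonempty (hG : SharplyTransitive k G) {I : Finset (Fin k)}
    (hI : I.card ≤ n - k) (σ : Equiv.Perm {j : Fin k // j ∉ I}) :
    (permMember hk G I σ).Nonempty :=
  member_nonempty hk hG hI
    ((lastPoint_injective hk).comp (Subtype.val_injective.comp σ.injective))
    fun _ => le_lastPoint hk _

/-- One common element recovers both `I` and the permutation from its tuple. Together with
nonemptiness this makes the parametrization of members injective. -/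
theorem permMember_inj {I J : Finset (Fin k)} {σ : Equiv.Perm {j : Fin k // j ∉ I}}
    {τ : Equiv.Perm {j : Fin k // j ∉ J}} {x : G} (hσ : x ∈ permMember hk G I σ)
    (hτ : x ∈ permMember hk G J τ) :
    (⟨I, σ⟩ : Σ I : Finset (Fin k), Equiv.Perm {j : Fin k // j ∉ I}) = ⟨J, τ⟩ := by
  obtain rfl : I = J := Finset.coe_injective (hσ.1.symm.trans hτ.1)
  obtain rfl : σ = τ := Equiv.ext fun j => Subtype.ext
    (lastPoint_injective hk ((hσ.2 j).symm.trans (hτ.2 j)))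
  rfl

theorem exists_orbit_of_mem_family (hG : SharplyTransitive k G)
    (hFG : Subgroup.IsComplement' (fixLast n k) G) {m : ℕ} (hmn : m ≤ n - k) {S : Set G}
    (hS : S ∈ family hk G m) : ∃ x : G, S = (exactMatchedPair hFG).orbit x := by
  obtain ⟨I, D, rfl, hDi, hD, rfl⟩ := hS
  obtain ⟨x, hx⟩ := member_nonempty (G := G) hk hG hmn hDi hD
  exact ⟨x, (orbit_eq_member hk hG hFG hD hx).symm⟩

theorem mem_family_and_not_isNullIndicatorOrbit_iff (𝕜 : Type u) [Field 𝕜] [CharZero 𝕜]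
    (hG : SharplyTransitive k G) (hFG : Subgroup.IsComplement' (fixLast n k) G) {m : ℕ}
    (hmn : m ≤ n - k) (S : Set G) :
    (S ∈ family hk G m ∧ ¬ (exactMatchedPair hFG).IsNullIndicatorOrbit 𝕜 S) ↔
      ∃ (I : Finset (Fin k)) (σ : Equiv.Perm {j : Fin k // j ∉ I}),
        I.card = m ∧ σ ^ 2 = 1 ∧ permMember hk G I σ = S := by
  constructor
  · rintro ⟨⟨I, D, hI, hDi, hD, rfl⟩, hS⟩
    obtain ⟨x, hx⟩ := member_nonempty (G := G) hk hG (hI.trans_le hmn) hDi hD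
    choose d hd using fun j => exists_lastPoint_eq hk (hD j)
    obtain rfl : (fun j => lastPoint hk (d j)) = D := funext hd
    rw [← orbit_eq_member hk hG hFG hD hx, MatchedPair.isNullIndicatorOrbit_orbit_iff,
      not_not, inv_mem_orbit_iff hk hG hFG hx] at hS
    choose h h' using hS
    -- Self-inverseness includes that `d` avoids `I`, so `d` restricts to a self-map of the
    -- complement; being involutive, it is a permutation.
    let s : {j : Fin k // j ∉ I} → {j : Fin k // j ∉ I} := fun j => ⟨d j, h j⟩
    have hs : Function.Involutive s := fun j => Subtype.ext (h' j)
    exact ⟨I, hs.toPerm, hI, Equiv.ext fun j => hs j, rfl⟩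
  · rintro ⟨I, σ, hI, hσ, rfl⟩
    obtain ⟨x, hx⟩ := permMember_nonempty (G := G) hk hG (hI.trans_le hmn) σ
    refine ⟨⟨I, _, hI, (lastPoint_injective hk).comp (Subtype.val_injective.comp σ.injective),
      fun _ => le_lastPoint hk _, rfl⟩, ?_⟩
    rw [permMember, ← orbit_eq_member hk hG hFG (fun _ => le_lastPoint hk _) hx,
      MatchedPair.isNullIndicatorOrbit_orbit_iff, not_not, inv_mem_orbit_iff hk hG hFG hx]
    exact fun j => ⟨(σ j).2, congrArg Subtype.val (Equiv.ext_iff.mp hσ j)⟩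

end SymGroup

/-! ### The count -/

theorem card_involutions_perm (α : Type*) [Finite α] :
    Nat.card {σ : Equiv.Perm α // σ ^ 2 = 1} = numInvolutions (Nat.card α) := by
  let e := (Finite.equivFin α).permCongrHom
  exact Nat.card_congr (e.toEquiv.subtypeEquiv fun σ => by
    change σ ^ 2 = 1 ↔ e σ ^ 2 = 1
    rw [← map_pow, map_eq_one_iff e e.injective])

theorem mainTheorem4 {𝕜 : Type u} [Field 𝕜] [IsAlgClosed 𝕜] [CharZero 𝕜]
    {n k m : ℕ} (hk1 : 1 ≤ k) (hk : k ≤ n) (G : Subgroup (SymGroup n))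
    (hG : SymGroup.SharplyTransitive k G)
    (hFG : Subgroup.IsComplement' (SymGroup.fixLast n k) G)
    (hmk : m ≤ k) (hmn : m ≤ n - k) :
    (∀ S ∈ SymGroup.family hk G m, ∃ x : G, S = (exactMatchedPair hFG).orbit x) ∧
    {S ∈ SymGroup.family hk G m |
        ¬ (exactMatchedPair hFG).IsNullIndicatorOrbit 𝕜 S}.ncard
      = k.choose m * numInvolutions (k - m) := by
  refine ⟨fun S hS => SymGroup.exists_orbit_of_mem_family hk hG hFG hmn hS, ?_⟩
  -- The non-null members are the injective image of the pairs `(I, σ)` with `σ ^ 2 = 1`; the fibre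
  -- over each `I` has the same size because the complement of `I` has `k - m` elements.
  let Φ : (Σ I : {I : Finset (Fin k) // I.card = m},
      {σ : Equiv.Perm {j : Fin k // j ∉ I.1} // σ ^ 2 = 1}) → Set G :=
    fun p => SymGroup.permMember hk G p.1.1 p.2.1
  have hΦ : Function.Injective Φ := by
    rintro ⟨⟨I, hI⟩, σ, hσ⟩ ⟨⟨J, hJ⟩, τ, hτ⟩ h
    obtain ⟨x, hx⟩ := SymGroup.permMember_nonempty (G := G) hk hG (hI.trans_le hmn) σ
    have hx' : x ∈ SymGroup.permMember hk G J τ := by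
      change x ∈ Φ ⟨⟨J, hJ⟩, τ, hτ⟩
      rw [← h]; exact hx
    cases SymGroup.permMember_inj hk hx hx'
    rfl
  have hrange : {S ∈ SymGroup.family hk G m |
      ¬ (exactMatchedPair hFG).IsNullIndicatorOrbit 𝕜 S} = Set.range Φ := by
    ext S
    refine (SymGroup.mem_family_and_not_isNullIndicatorOrbit_iff hk 𝕜 hG hFG hmn S).trans ⟨?_, ?_⟩
    · rintro ⟨I, σ, hI, hσ, rfl⟩
      exact ⟨⟨⟨I, hI⟩, σ, hσ⟩, rfl⟩
    · rintro ⟨⟨⟨I, hI⟩, σ, hσ⟩, rfl⟩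
      exact ⟨I, σ, hI, hσ, rfl⟩
  have hcard : ∀ I : {I : Finset (Fin k) // I.card = m},
      Nat.card {σ : Equiv.Perm {j : Fin k // j ∉ I.1} // σ ^ 2 = 1} = numInvolutions (k - m) := by
    intro I
    rw [card_involutions_perm, Nat.card_eq_fintype_card, Fintype.card_subtype_compl,
      Fintype.card_fin, Fintype.card_coe, I.2]
  rw [hrange, ← Nat.card_coe_set_eq, Nat.card_range_of_injective hΦ, Nat.card_sigma]
  simp only [hcard, Finset.sum_const, Finset.card_univ, Fintype.card_finset_len, Fintype.card_fin,
    smul_eq_mul]
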